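/- Let $k$ be an algebraically closed field. A *graded algebra* is a unital associative $\mathbb N$-graded $k$-algebra $A=\bigoplus_{n\ge 0}A_n$ that is connected ($A_0=k\ne 0$) and finitely generated. A *graded twisted tensor product* of graded algebras $A$ and $B$ is a triple $(C,i_A,i_B)$ of a graded algebra $C$ and injective graded algebra homomorphisms $i_A:A\to C$, $i_B:B\to C$ such that the linear map $A\otimes B\to C$, $p\otimes q\mapsto i_A(p)\,i_B(q)$, is bijective. Two such triples $(C,i_A,i_B)$ and $(C',i'_A,i'_B)$ are *isomorphic* if there are graded algebra isomorphisms $\alpha:A\to A$, $\beta:B\to B$, $\gamma:C\to C'$ with $\gamma i_A=i'_A\alpha$ and $\gamma i_B=i'_B\beta$. A graded algebra $C$ is *quadratic* if it is generated in degree $1$ and the kernel of the canonical map $T(C_1)\to C$ from the tensor algebra is generated, as a two-sided ideal, by elements of degree $2$; a graded twisted tensor product $(C,i_A,i_B)$ is called quadratic if $C$ is. For $a,b,c\in k$ let $C(a,b,c)=k\langle x,z\rangle/(zx-ax^2-bxz-cz^2)$, graded with $x,z$ in degree $1$, together with the evident homomorphisms $k[x]\to C(a,b,c)$, $x\mapsto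 x$, and $k[z]\to C(a,b,c)$, $z\mapsto z$; the polynomial rings $k[x]$ and $k[z]$ have the standard grading. Define $e_n,f_n\in k[t,u]$ by $e_0=f_0=1$ and, for $n\ge 1$, $$e_n=u\,e_{n-1}+f_{n-1},\qquad f_n=-t\,e_{n-1}+f_{n-1}.$$ **Theorem.** 1. For $a,b\in k$, the algebra $C(a,b,1)$ with the evident homomorphisms is a graded twisted tensor product of $k[x]$ and $k[z]$ if and only if $f_n(a,b)\neq 0$ for all $n\ge 0$. 2. For all $a,b\in k$, the algebra $C(a,b,0)$ with the evident homomorphisms is a graded twisted tensor product of $k[x]$ and $k[z]$. 3. Let $(C,i_A,i_B)$ be a graded twisted tensor product of $k[x]$ and $k[z]$ and let $a,b,c\in k$ be such that $i_B(z)i_A(x)=a\,i_A(x)^2+b\,i_A(x)i_B(z)+c\,i_B(z)^2$. If $a=0$ or $c=0$, then $C$ is quadratic and $(C,i_A,i_B)$ is isomorphic, as a graded twisted tensor product, to $C(a,b,c)$ with the evident homomorphisms. 4. Every quadratic twisted tensor product of $k[x]$ and $k[z]$ is isomorphic, as a graded twisted tensor product, to $C(a,b,1)$ or $C(a,b,0)$,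 with the evident homomorphisms, for some $a,b\in k$. -/

import Mathlib

open scoped TensorProduct Polynomial

universe u v

noncomputable section

namespace TwistedTensor

/-- `𝒜` makes the unital associative `k`-algebra `A` into a graded algebra `A = ⨁ n, A_n`
which is connected (`A_0 = k`, one-dimensional) and finitely generated. (For a graded algebra,
being finitely generated and being generated by finitely many homogeneous elements are the same:
take homogeneous components of the generators.) -/
structure IsGradedAlg {k A : Type*} [Field k] [Ring A] [Algebra k A]
    (𝒜 : ℕ → Submodule k A) : Prop where
  gradedMonoid : SetLike.GradedMonoid 𝒜
  isInternal : DirectSum.IsInternal 𝒜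
  nontrivial : Nontrivial A
  connected : 𝒜 0 = 1
  finiteType : Algebra.FiniteType k A

/-- The linear map `A ⊗ B → C`, `a ⊗ b ↦ i_A(a) i_B(b)`. -/
def mulMap {k A B C : Type*} [Field k] [Ring A] [Algebra k A] [Ring B] [Algebra k B]
    [Ring C] [Algebra k C] (iA : A →ₐ[k] C) (iB : B →ₐ[k] C) : A ⊗[k] B →ₗ[k] C :=
  TensorProduct.lift ((LinearMap.mul k C).compl₁₂ iA.toLinearMap iB.toLinearMap)

/-- `(C, i_A, i_B)` is a graded twisted tensor product of the graded algebras `A` and `B`. -/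
structure IsGradedTTP {k A B C : Type*} [Field k] [Ring A] [Algebra k A] [Ring B] [Algebra k B]
    [Ring C] [Algebra k C] (𝒜 : ℕ → Submodule k A) (ℬ : ℕ → Submodule k B)
    (𝒞 : ℕ → Submodule k C) (iA : A →ₐ[k] C) (iB : B →ₐ[k] C) : Prop where
  gradedA : IsGradedAlg 𝒜
  gradedB : IsGradedAlg ℬ
  gradedC : IsGradedAlg 𝒞
  map_A : ∀ n, ∀ a ∈ 𝒜 n, iA a ∈ 𝒞 n
  map_B : ∀ n, ∀ b ∈ ℬ n, iB b ∈ 𝒞 n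
  injective_A : Function.Injective iA
  injective_B : Function.Injective iB
  bijective : Function.Bijective (mulMap iA iB)

/-- Isomorphism of the triples `(C, i_A, i_B)` and `(C', i_A', i_B')`: graded algebra isomorphisms
`α : A → A`, `β : B → B`, `γ : C → C'` with `γ i_A = i_A' α` and `γ i_B = i_B' β`. -/
def IsoTTP {k A B C C' : Type*} [Field k] [Ring A] [Algebra k A] [Ring B] [Algebra k B]
    [Ring C] [Algebra k C] [Ring C'] [Algebra k C']
    (𝒜 : ℕ → Submodule k A) (ℬ : ℕ → Submodule k B)
    (𝒞 : ℕ → Submodule k C) (iA : A →ₐ[k] C) (iB : B →ₐ[k] C)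
    (𝒞' : ℕ → Submodule k C') (iA' : A →ₐ[k] C') (iB' : B →ₐ[k] C') : Prop :=
  ∃ (α : A ≃ₐ[k] A) (β : B ≃ₐ[k] B) (γ : C ≃ₐ[k] C'),
    (∀ n, (𝒜 n).map α.toLinearMap = 𝒜 n) ∧
    (∀ n, (ℬ n).map β.toLinearMap = ℬ n) ∧
    (∀ n, (𝒞 n).map γ.toLinearMap = 𝒞' n) ∧
    (∀ a, γ (iA a) = iA' (α a)) ∧
    (∀ b, γ (iB b) = iB' (β b))

/-- The canonical homomorphism `T(C_1) → C` from the tensor algebra on the degree-one part. -/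
def tensorProj {k C : Type*} [Field k] [Ring C] [Algebra k C] (𝒞 : ℕ → Submodule k C) :
    TensorAlgebra k (𝒞 1) →ₐ[k] C :=
  TensorAlgebra.lift k (𝒞 1).subtype

/-- A graded algebra `C` is quadratic if it is generated in degree one and the kernel of
`T(C_1) → C` is generated, as a two-sided ideal, by its elements of degree two. -/
structure IsQuadratic {k C : Type*} [Field k] [Ring C] [Algebra k C]
    (𝒞 : ℕ → Submodule k C) : Prop where
  graded : IsGradedAlg 𝒞
  generated : Algebra.adjoin k (𝒞 1 : Set C) = ⊤
  kernel : TwoSidedIdeal.ker (tensorProj 𝒞) =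
    TwoSidedIdeal.span {w | w ∈ LinearMap.range (TensorAlgebra.ι k (M := 𝒞 1)) ^ 2 ∧
      tensorProj 𝒞 w = 0}

/-- The standard grading of the polynomial ring in one variable: the degree `n` part is the line
spanned by the `n`-th power of the variable. -/
def polyGrading (k : Type*) [Field k] (n : ℕ) : Submodule k k[X] :=
  Submodule.span k {(Polynomial.X : k[X]) ^ n}

/-- The defining relation `z x = a x² + b x z + c z²` on the free algebra `k⟨x, z⟩`, where `x` and
`z` are the free generators number `0` and `1`. -/
inductive CRel {k : Type*} [Field k] (a b c : k) :
    FreeAlgebra k (Fin 2) → FreeAlgebra k (Fin 2) → Prop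
  | rel : CRel a b c (FreeAlgebra.ι k 1 * FreeAlgebra.ι k 0)
      (a • FreeAlgebra.ι k 0 ^ 2 + b • (FreeAlgebra.ι k 0 * FreeAlgebra.ι k 1)
        + c • FreeAlgebra.ι k 1 ^ 2)

/-- `C(a, b, c) = k⟨x, z⟩ / (z x - a x² - b x z - c z²)`. -/
abbrev CAlg {k : Type*} [Field k] (a b c : k) : Type _ := RingQuot (CRel a b c)

/-- The class of the generator `x` in `C(a, b, c)`. -/
def CAlg.x {k : Type*} [Field k] (a b c : k) : CAlg a b c :=
  RingQuot.mkAlgHom k (CRel a b c) (FreeAlgebra.ι k 0)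

/-- The class of the generator `z` in `C(a, b, c)`. -/
def CAlg.z {k : Type*} [Field k] (a b c : k) : CAlg a b c :=
  RingQuot.mkAlgHom k (CRel a b c) (FreeAlgebra.ι k 1)

/-- The standard grading of `C(a, b, c)`, with `x` and `z` in degree one: the degree `n` part is
the span of the words of length `n` in `x` and `z`. -/
def CAlg.grading {k : Type*} [Field k] (a b c : k) (n : ℕ) : Submodule k (CAlg a b c) :=
  Submodule.span k {CAlg.x a b c, CAlg.z a b c} ^ n

/-- The evident map `k[x] → C(a, b, c)`, `x ↦ x`. -/
def CAlg.inclX {k : Type*} [Field k] (a b c : k) : k[X] →ₐ[k] CAlg a b c :=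
  Polynomial.aeval (CAlg.x a b c)

/-- The evident map `k[z] → C(a, b, c)`, `z ↦ z`. -/
def CAlg.inclZ {k : Type*} [Field k] (a b c : k) : k[X] →ₐ[k] CAlg a b c :=
  Polynomial.aeval (CAlg.z a b c)

/-- The pair `(e_n, f_n)` of polynomials in `k[t, u]` (`t` is variable `0`, `u` is variable `1`):
`e_0 = f_0 = 1`, `e_n = u e_{n-1} + f_{n-1}`, `f_n = -t e_{n-1} + f_{n-1}`. -/
def efPoly (k : Type*) [Field k] : ℕ → MvPolynomial (Fin 2) k × MvPolynomial (Fin 2) k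
  | 0 => (1, 1)
  | n + 1 =>
    (MvPolynomial.X 1 * (efPoly k n).1 + (efPoly k n).2,
      -MvPolynomial.X 0 * (efPoly k n).1 + (efPoly k n).2)

/-- The polynomial `f_n(t, u)`. -/
def fPoly (k : Type*) [Field k] (n : ℕ) : MvPolynomial (Fin 2) k := (efPoly k n).2

end TwistedTensor

end

/-!
Everything rests on computing normal forms. If the monomials `x ^ i z ^ j` span an algebra with
`z x = a x² + b x z + c z²`, then `z x ^ n` is a combination of monomials of degree `n + 1`; let
`λ_n` be the coefficient of `x ^ (n + 1)` in it. Expanding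
`z x ^ (n + 1) = a x ^ (n + 2) + b x (z x ^ n) + c z (z x ^ n)`, where the last summand contains
`c λ_n z x ^ (n + 1)`, gives `λ_0 = 0` and `(1 - c λ_n) λ_{n + 1} = a + b λ_n`. This is
`leadCoeff`, and `zMulXPow` is the resulting recursion for the whole normal form.

If `c λ_n ≠ 1` for all `n`, the recursion never divides by zero and defines an action of
`C(a, b, c)` on the space of formal normal forms, so that the `x ^ i z ^ j` form a basis of
`C(a, b, c)` (`CAlg.bijective_evalNF`). The condition clearly holds if `c = 0`, and also if `a = 0`,
since then all `λ_n` vanish. For `c = 1` one has `λ_{n + 1} = a e_n / f_n`, so that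
`1 - λ_{n + 1} = f_{n + 1} / f_n` and the condition says that no `f_n(a, b)` vanishes.

Conversely, if the `x ^ i z ^ j` form a basis of `C(a, b, 1)` and `n` is the first index with
`λ_n = 1`, comparing coefficients gives `a + b = 0`, hence `λ_n = a`, so `a = 1` and `b = -1`. But
`C(1, -1, 1)` is `k⟨x, w⟩ / (w²)` with `w = x - z`, which the `x ^ i z ^ j` do not span
(`CAlg.not_surjective_evalNF`).

A twisted tensor product `C` of `k[x]` and `k[z]` has its degree `n` part spanned by the monomials
`x ^ i z ^ j` of degree `n`, so it satisfies a relation as above and is a quotient of `C(a, b, c)`.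
If `a = 0` or `c = 0`, both have the basis `x ^ i z ^ j`, hence are isomorphic. If `C` is quadratic,
its degree-two relations all follow from the given one, because `x²`, `x z`, `z²` are independent,
and again `C` is isomorphic to `C(a, b, c)`; rescaling `z` by `c` makes a nonzero `c` equal to `1`.
-/

noncomputable section

namespace TwistedTensor

/-! ### Gradings generated in degree one -/

section Grading

variable {k A : Type*} [Field k] [Ring A] [Algebra k A]

/-- Two families of subspaces, one inside the other, coincide as soon as the larger is independent
and the smaller spans. -/
theorem eq_of_le_of_iSupIndep_of_iSup_eq_top {𝒜 ℬ : ℕ → Submodule k A} (hle : ∀ n, 𝒜 n ≤ ℬ n)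
    (hind : iSupIndep ℬ) (htop : ⨆ n, 𝒜 n = ⊤) (n : ℕ) : 𝒜 n = ℬ n := by
  refine eq_of_le_of_inf_le_of_sup_le (z := ⨆ j, ⨆ _ : j ≠ n, ℬ j) (hle n) ?_ ?_
  · rw [(hind n).eq_bot]
    exact bot_le
  · refine le_trans le_top (htop ▸ iSup_le fun m => ?_)
    by_cases h : m = n
    · subst h
      exact le_sup_left
    · exact ((hle m).trans (le_iSup₂ (f := fun j (_ : j ≠ n) => ℬ j) m h)).trans le_sup_right

theorem iSup_span_pow_eq_top {S : Set A} (hS : Algebra.adjoin k S = ⊤) :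
    ⨆ n, Submodule.span k S ^ n = ⊤ := by
  rw [eq_top_iff, ← Algebra.top_toSubmodule, ← hS, Algebra.adjoin_eq_span, Submodule.span_le]
  intro s hs
  have : ∃ n, s ∈ Submodule.span k S ^ n := by
    induction hs using Submonoid.closure_induction with
    | mem x hx => exact ⟨1, by simpa using Submodule.subset_span hx⟩
    | one => exact ⟨0, by rw [pow_zero]; exact Submodule.one_le.1 le_rfl⟩
    | mul x y _ _ hx hy =>
      obtain ⟨m, hm⟩ := hx
      obtain ⟨n, hn⟩ := hy
      exact ⟨m + n, by rw [pow_add]; exact Submodule.mul_mem_mul hm hn⟩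
  obtain ⟨n, hn⟩ := this
  exact Submodule.mem_iSup_of_mem n hn

/-- A homomorphism `A → A[T]` sending each generator `s` to `s T` sends every element `x` of degree
`n` to `x T ^ n`. -/
theorem map_eq_monomial_of_mem_span_pow {S : Set A} (f : A →ₐ[k] A[X])
    (hf : ∀ s ∈ S, f s = Polynomial.monomial 1 s) {n : ℕ} {x : A}
    (hx : x ∈ Submodule.span k S ^ n) : f x = Polynomial.monomial n x := by
  have hV : ∀ v ∈ Submodule.span k S, f v = Polynomial.monomial 1 v := by
    intro v hv
    induction hv using Submodule.span_induction with
    | mem x hx => exact hf x hx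
    | zero => simp
    | add x y _ _ hx hy => simp [hx, hy]
    | smul r x _ hx => rw [map_smul, hx, Polynomial.smul_monomial]
  induction hx using Submodule.pow_induction_on_left' with
  | algebraMap r => rw [AlgHom.commutes]; rfl
  | add x y i _ _ hx hy => simp [hx, hy]
  | mem_mul m hm i x _ hx =>
    rw [map_mul, hV m hm, hx, Polynomial.monomial_mul_monomial, Nat.succ_eq_add_one, add_comm]

/-- An algebra generated by a finite set `S` is graded by the powers of the span of `S` as soon as
the defining relations are homogeneous; homogeneity is expressed by the existence of the
homomorphism `A → A[T]`, `s ↦ s T`, which separates the degrees. -/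
theorem IsGradedAlg.of_adjoin_eq_top [Nontrivial A] {S : Set A} (hfin : S.Finite)
    (hS : Algebra.adjoin k S = ⊤) (f : A →ₐ[k] A[X])
    (hf : ∀ s ∈ S, f s = Polynomial.monomial 1 s) :
    IsGradedAlg (fun n => Submodule.span k S ^ n) where
  gradedMonoid :=
    { one_mem := by simp
      mul_mem := fun i j x y hx hy => by rw [pow_add]; exact Submodule.mul_mem_mul hx hy }
  isInternal := by
    refine DirectSum.isInternal_submodule_of_iSupIndep_of_iSup_eq_top (fun n => ?_)
      (iSup_span_pow_eq_top hS)
    rw [Submodule.disjoint_def]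
    intro x hx hx'
    have hle : ⨆ j, ⨆ _ : j ≠ n, Submodule.span k S ^ j ≤
        LinearMap.ker (((Polynomial.lcoeff A n).restrictScalars k).comp f.toLinearMap) := by
      refine iSup₂_le fun j hj y hy => ?_
      simp [map_eq_monomial_of_mem_span_pow f hf hy, Polynomial.coeff_monomial, hj]
    have h0 := hle hx'
    simpa [map_eq_monomial_of_mem_span_pow f hf hx] using h0
  nontrivial := inferInstance
  connected := pow_zero _
  finiteType := ⟨⟨hfin.toFinset, by simpa using hS⟩⟩

theorem isGradedAlg_polyGrading (k : Type*) [Field k] : IsGradedAlg (polyGrading k) := by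
  have h : polyGrading k = fun n => Submodule.span k {(Polynomial.X : k[X])} ^ n := by
    funext n
    rw [Submodule.span_pow, Set.singleton_pow]
    rfl
  rw [h]
  exact IsGradedAlg.of_adjoin_eq_top (Set.finite_singleton _) Polynomial.adjoin_X
    (Polynomial.aeval (Polynomial.monomial 1 Polynomial.X)) (by simp)

end Grading

/-! ### The algebra `C(a, b, c)` -/

namespace CAlg

variable {k : Type*} [Field k] (a b c : k)

theorem z_mul_x : z a b c * x a b c =
    a • x a b c ^ 2 + b • (x a b c * z a b c) + c • z a b c ^ 2 := by
  simpa [x, z] using RingQuot.mkAlgHom_rel k (CRel.rel (a := a) (b := b) (c := c))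

section Lift

variable {a b c} {A : Type*} [Ring A] [Algebra k A]

/-- The universal property of `C(a, b, c)`. -/
def lift (X Z : A) (h : Z * X = a • X ^ 2 + b • (X * Z) + c • Z ^ 2) : CAlg a b c →ₐ[k] A :=
  RingQuot.liftAlgHom k ⟨FreeAlgebra.lift k ![X, Z], by rintro _ _ ⟨⟩; simpa using h⟩

variable (X Z : A) (h : Z * X = a • X ^ 2 + b • (X * Z) + c • Z ^ 2)

@[simp]
theorem lift_x : lift X Z h (x a b c) = X := by simp [lift, x]

@[simp]
theorem lift_z : lift X Z h (z a b c) = Z := by simp [lift, z]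

end Lift

theorem adjoin_x_z : Algebra.adjoin k {x a b c, z a b c} = ⊤ := by
  have h := congrArg (Subalgebra.map (RingQuot.mkAlgHom k (CRel a b c)))
    (FreeAlgebra.adjoin_range_ι k (Fin 2))
  rw [AlgHom.map_adjoin, Algebra.map_top,
    (AlgHom.range_eq_top _).2 (RingQuot.mkAlgHom_surjective k _)] at h
  rw [← h]
  congr 1
  ext y
  simp [x, z, eq_comm]

theorem isGradedAlg_grading : IsGradedAlg (grading a b c) := by
  have : Nontrivial (CAlg a b c) :=
    (lift (0 : k) 0 (by simp) : CAlg a b c →ₐ[k] k).toRingHom.domain_nontrivial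
  refine IsGradedAlg.of_adjoin_eq_top (Set.toFinite _) (adjoin_x_z a b c)
    (lift (Polynomial.monomial 1 (x a b c)) (Polynomial.monomial 1 (z a b c)) ?_) ?_
  · simp only [pow_two, Polynomial.monomial_mul_monomial, Polynomial.smul_monomial, ← map_add,
      z_mul_x]
  · simp

end CAlg
/-! ### Normal forms of `z x ^ n` -/

section NormalForm

open Polynomial

variable {k : Type*} [Field k] (a b c : k)

/-- The coefficient of `x ^ (n + 1)` in the normal form of `z x ^ n`. The recursion is meaningful
as long as no denominator `1 - c * leadCoeff a b c n` vanishes. -/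
def leadCoeff : ℕ → k
  | 0 => 0
  | n + 1 => (a + b * leadCoeff n) / (1 - c * leadCoeff n)

/-- The normal form of `z x ^ n` with respect to the monomials `x ^ i z ^ j`. Here and below the
elements of `k[X][X]` stand for formal combinations of such monomials: the outer variable is `x`
and the inner one, in which the coefficients are written on the right of the powers of `x`,
is `z`. -/
def zMulXPow : ℕ → k[X][X]
  | 0 => C X
  | n + 1 => (1 - c * leadCoeff a b c n)⁻¹ • (a • X ^ (n + 2) + b • (X * zMulXPow n) +
      c • ∑ i : Fin (n + 1), (zMulXPow n).coeff i • zMulXPow i)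

/-- What is left of the normal form of `(a x² + b x z + c z²) x ^ n` once the multiple
`c * leadCoeff a b c n` of `z x ^ (n + 1)` occurring in `c z (z x ^ n)` is moved to the left-hand
side. -/
def zMulXPowRest (n : ℕ) : k[X][X] :=
  a • X ^ (n + 2) + b • (X * zMulXPow a b c n) +
    c • ∑ i ∈ Finset.range (n + 1), (zMulXPow a b c n).coeff i • zMulXPow a b c i

theorem zMulXPow_zero : zMulXPow a b c 0 = C X := by rw [zMulXPow]

theorem zMulXPow_succ (n : ℕ) :
    zMulXPow a b c (n + 1) = (1 - c * leadCoeff a b c n)⁻¹ • zMulXPowRest a b c n := by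
  rw [zMulXPow, zMulXPowRest, Finset.sum_range]

theorem coeff_zMulXPowRest_of_coeff_zMulXPow {n : ℕ}
    (h : ∀ m ≤ n, ∀ j, m + 1 < j → (zMulXPow a b c m).coeff j = 0) (j : ℕ) (hj : n + 2 ≤ j) :
    (zMulXPowRest a b c n).coeff j =
      (if j = n + 2 then C a else 0) + b • (zMulXPow a b c n).coeff (j - 1) := by
  obtain ⟨j, rfl⟩ : ∃ i, j = i + 1 := ⟨j - 1, by omega⟩
  have hsum : ∀ i ∈ Finset.range (n + 1),
      (zMulXPow a b c n).coeff i • (zMulXPow a b c i).coeff (j + 1) = 0 := by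
    intro i hi
    rw [Finset.mem_range] at hi
    rw [h i (by omega) _ (by omega), smul_zero]
  simp only [zMulXPowRest, coeff_add, coeff_smul, finsetSum_coeff, Finset.sum_eq_zero hsum,
    coeff_X_pow, coeff_X_mul, smul_zero, add_zero, Nat.add_sub_cancel, smul_ite]
  rw [Polynomial.smul_eq_C_mul a, mul_one]

theorem coeff_zMulXPow (n : ℕ) :
    (∀ j, n + 1 < j → (zMulXPow a b c n).coeff j = 0) ∧
      (zMulXPow a b c n).coeff (n + 1) = C (leadCoeff a b c n) := by
  induction n using Nat.strong_induction_on with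
  | _ n ih =>
    rcases n with _ | n
    · refine ⟨fun j hj => ?_, ?_⟩
      · rw [zMulXPow_zero, coeff_C, if_neg (by omega)]
      · rw [zMulXPow_zero, coeff_C, if_neg (by omega), leadCoeff, C_0]
    · have h := coeff_zMulXPowRest_of_coeff_zMulXPow a b c (n := n)
        fun m hm => (ih m (by omega)).1
      refine ⟨fun j hj => ?_, ?_⟩
      · rw [zMulXPow_succ, coeff_smul, h j (by omega), if_neg (by omega),
          (ih n (by omega)).1 _ (by omega)]
        simp
      · rw [zMulXPow_succ, coeff_smul, h _ (by omega), if_pos rfl, Nat.add_sub_cancel,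
          (ih n (by omega)).2, leadCoeff, smul_C, ← C_add, smul_C, smul_eq_mul, smul_eq_mul,
          div_eq_inv_mul]

theorem natDegree_zMulXPow_le (n : ℕ) : (zMulXPow a b c n).natDegree ≤ n + 1 :=
  natDegree_le_iff_coeff_eq_zero.2 (coeff_zMulXPow a b c n).1

theorem coeff_zMulXPowRest (n : ℕ) :
    (zMulXPowRest a b c n).coeff (n + 2) = C (a + b * leadCoeff a b c n) := by
  rw [coeff_zMulXPowRest_of_coeff_zMulXPow a b c (fun m _ => (coeff_zMulXPow a b c m).1) _ le_rfl,
    if_pos rfl, show n + 2 - 1 = n + 1 from rfl, (coeff_zMulXPow a b c n).2, smul_C, C_add,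
    smul_eq_mul]

theorem zMulXPow_eq_sum (n : ℕ) : zMulXPow a b c n =
    ∑ i ∈ Finset.range (n + 1), monomial i ((zMulXPow a b c n).coeff i) +
      monomial (n + 1) (C (leadCoeff a b c n)) := by
  conv_lhs => rw [as_sum_range' _ (n + 2) (Nat.lt_succ_of_le (natDegree_zMulXPow_le a b c n))]
  rw [Finset.sum_range_succ, (coeff_zMulXPow a b c n).2]

end NormalForm

/-! ### Evaluating normal forms in a twisted tensor product -/

section Evaluation

open Polynomial

variable {k : Type*} [Field k] {A : Type*} [Ring A] [Algebra k A] (iA iB : k[X] →ₐ[k] A)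

/-- The identification of `k[X][X]` with `k[x] ⊗ k[z]` under which `x ^ i q(z)` corresponds to
`x ^ i ⊗ q(z)`. -/
def normalFormEquiv (k : Type*) [Field k] : k[X][X] ≃ₗ[k] k[X] ⊗[k] k[X] :=
  (polyEquivTensor k k[X]).toLinearEquiv ≪≫ₗ TensorProduct.comm k k[X] k[X]

/-- The evaluation of normal forms, `x ^ i q(z) ↦ i_A(x) ^ i i_B(q)`. -/
def evalNF : k[X][X] →ₗ[k] A := mulMap iA iB ∘ₗ (normalFormEquiv k).toLinearMap

theorem bijective_evalNF_iff :
    Function.Bijective (evalNF iA iB) ↔ Function.Bijective (mulMap iA iB) := by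
  rw [evalNF, LinearMap.coe_comp]
  exact Function.Bijective.of_comp_iff _ (normalFormEquiv k).bijective

@[simp]
theorem evalNF_monomial (i : ℕ) (q : k[X]) :
    evalNF iA iB (monomial i q) = iA X ^ i * iB q := by
  simp [evalNF, normalFormEquiv, polyEquivTensor_apply, mulMap]

@[simp]
theorem evalNF_X_pow (i : ℕ) : evalNF iA iB (X ^ i) = iA X ^ i := by
  rw [X_pow_eq_monomial, evalNF_monomial, map_one, mul_one]

@[simp]
theorem evalNF_C (q : k[X]) : evalNF iA iB (C q) = iB q := by
  rw [← monomial_zero_left, evalNF_monomial, pow_zero, one_mul]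

theorem evalNF_X_mul (m : k[X][X]) : evalNF iA iB (X * m) = iA X * evalNF iA iB m := by
  induction m using Polynomial.induction_on' with
  | add p q hp hq => rw [mul_add, map_add, hp, hq, map_add, mul_add]
  | monomial i q => rw [X_mul_monomial, evalNF_monomial, evalNF_monomial, pow_succ', mul_assoc]

theorem evalNF_smul (q : k[X]) (m : k[X][X]) :
    evalNF iA iB (q • m) = evalNF iA iB m * iB q := by
  induction m using Polynomial.induction_on' with
  | add p q hp hq => rw [smul_add, map_add, hp, hq, map_add, add_mul]
  | monomial i p =>
    rw [smul_monomial, evalNF_monomial, evalNF_monomial, smul_eq_mul, mul_comm, map_mul, mul_assoc]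

variable {iA iB} {a b c : k}
  (h : iB X * iA X = a • iA X ^ 2 + b • (iA X * iB X) + c • iB X ^ 2)

include h in
theorem one_sub_smul_z_mul_x_pow {n : ℕ}
    (hn : ∀ i ≤ n, evalNF iA iB (zMulXPow a b c i) = iB X * iA X ^ i) :
    (1 - c * leadCoeff a b c n) • (iB X * iA X ^ (n + 1)) =
      evalNF iA iB (zMulXPowRest a b c n) := by
  have hz : iB X * (iB X * iA X ^ n) =
      ∑ i ∈ Finset.range (n + 1),
        evalNF iA iB ((zMulXPow a b c n).coeff i • zMulXPow a b c i) +
        leadCoeff a b c n • (iB X * iA X ^ (n + 1)) := by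
    conv_lhs => rw [← hn n le_rfl, zMulXPow_eq_sum, map_add, map_sum, mul_add, Finset.mul_sum]
    congr 1
    · refine Finset.sum_congr rfl fun i hi => ?_
      rw [evalNF_monomial, evalNF_smul, hn i (by simpa [Nat.lt_succ_iff] using hi), mul_assoc]
    · rw [evalNF_monomial, C_eq_algebraMap, AlgHom.commutes, ← Algebra.commutes, ← Algebra.smul_def,
        mul_smul_comm]
  have hx : iB X * iA X ^ (n + 1) = a • iA X ^ (n + 2) + b • (iA X * (iB X * iA X ^ n)) +
      c • (iB X * (iB X * iA X ^ n)) := by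
    rw [pow_succ', ← mul_assoc, h]
    simp only [add_mul, smul_mul_assoc, pow_succ', pow_zero, mul_one, mul_assoc]
  rw [sub_smul, one_smul, mul_smul]
  conv_lhs => enter [1]; rw [hx, hz]
  simp only [zMulXPowRest, map_add, map_smul, map_sum, evalNF_X_mul, evalNF_X_pow, hn n le_rfl,
    smul_add]
  abel

include h in
/-- In any algebra satisfying the relation, `zMulXPow` computes `z x ^ n`, as long as the
denominators occurring up to that point do not vanish. -/
theorem evalNF_zMulXPow {n : ℕ} (hn : ∀ i < n, c * leadCoeff a b c i ≠ 1) :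
    evalNF iA iB (zMulXPow a b c n) = iB X * iA X ^ n := by
  induction n using Nat.strong_induction_on with
  | _ n ih =>
    rcases n with _ | n
    · rw [zMulXPow_zero, evalNF_C, pow_zero, mul_one]
    · have h1 := one_sub_smul_z_mul_x_pow h (n := n)
        fun i hi => ih i (by omega) fun j hj => hn j (by omega)
      rw [zMulXPow_succ, map_smul, ← h1, smul_smul,
        inv_mul_cancel₀ (sub_ne_zero.2 (hn n (by omega)).symm), one_smul]

end Evaluation

/-! ### The action of `C(a, b, c)` on normal forms -/

section Action

open Polynomial

variable {k : Type*} [Field k] (a b c : k)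

/-- Left multiplication by `z` on normal forms. -/
def zMul : k[X][X] →ₗ[k[X]] k[X][X] :=
  (basisMonomials k[X]).constr k[X] (zMulXPow a b c)

@[simp]
theorem zMul_monomial (n : ℕ) (q : k[X]) :
    zMul a b c (monomial n q) = q • zMulXPow a b c n := by
  rw [← mul_one q, ← smul_eq_mul, ← smul_monomial, map_smul, smul_eq_mul, mul_one, zMul,
    ← congrFun (coe_basisMonomials k[X]) n, Module.Basis.constr_basis]

variable {a b c} (hreg : ∀ n, c * leadCoeff a b c n ≠ 1)

include hreg in
theorem zMul_X_mul (m : k[X][X]) : zMul a b c (X * m) =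
    a • (X * (X * m)) + b • (X * zMul a b c m) + c • zMul a b c (zMul a b c m) := by
  have hrec (n : ℕ) : zMulXPow a b c (n + 1) = a • X ^ (n + 2) + b • (X * zMulXPow a b c n) +
      c • zMul a b c (zMulXPow a b c n) := by
    have hz : zMul a b c (zMulXPow a b c n) =
        ∑ i ∈ Finset.range (n + 1), (zMulXPow a b c n).coeff i • zMulXPow a b c i +
          leadCoeff a b c n • zMulXPow a b c (n + 1) := by
      conv_lhs => rw [zMulXPow_eq_sum]
      simp only [map_add, map_sum, zMul_monomial]
      rw [C_eq_algebraMap, algebraMap_smul]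
    have hG : (1 - c * leadCoeff a b c n) • zMulXPow a b c (n + 1) = zMulXPowRest a b c n := by
      rw [zMulXPow_succ, smul_smul, mul_inv_cancel₀ (sub_ne_zero.2 (hreg n).symm), one_smul]
    rw [sub_smul, one_smul, sub_eq_iff_eq_add, zMulXPowRest] at hG
    rw [hz, smul_add, smul_smul, ← add_assoc, ← hG]
  induction m using Polynomial.induction_on' with
  | add p q hp hq =>
    simp only [mul_add, map_add, hp, hq, smul_add]
    abel
  | monomial n q =>
    rw [X_mul_monomial, X_mul_monomial, zMul_monomial, zMul_monomial, hrec, map_smul,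
      smul_add, smul_add, smul_comm q a, smul_comm q b, smul_comm q c, X_pow_eq_monomial,
      smul_monomial, smul_eq_mul, mul_one, mul_smul_comm]

/-- `C(a, b, c)` acts on normal forms, provided that no denominator vanishes. -/
def actNF : CAlg a b c →ₐ[k] Module.End k k[X][X] :=
  CAlg.lift (LinearMap.mulLeft k X) ((zMul a b c).restrictScalars k) <| by
    ext1 m
    simpa [pow_two] using! zMul_X_mul hreg m

theorem actNF_x (m : k[X][X]) : actNF hreg (CAlg.x a b c) m = X * m := by
  simp [actNF]

theorem actNF_z (m : k[X][X]) : actNF hreg (CAlg.z a b c) m = zMul a b c m := by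
  simp [actNF]

theorem evalNF_actNF (u : CAlg a b c) (m : k[X][X]) :
    evalNF (CAlg.inclX a b c) (CAlg.inclZ a b c) (actNF hreg u m) =
      u * evalNF (CAlg.inclX a b c) (CAlg.inclZ a b c) m := by
  have hu : u ∈ Algebra.adjoin k {CAlg.x a b c, CAlg.z a b c} := by
    rw [CAlg.adjoin_x_z]
    trivial
  induction hu using Algebra.adjoin_induction generalizing m with
  | mem y hy =>
    rcases hy with rfl | rfl
    · rw [actNF_x, evalNF_X_mul, CAlg.inclX, aeval_X]
    · rw [actNF_z]
      induction m using Polynomial.induction_on' with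
      | add p q hp hq => rw [map_add, map_add, hp, hq, map_add, mul_add]
      | monomial n q =>
        rw [zMul_monomial, evalNF_smul, evalNF_zMulXPow (by
          simpa [CAlg.inclX, CAlg.inclZ] using CAlg.z_mul_x a b c) fun i _ => hreg i,
          evalNF_monomial, ← mul_assoc]
        simp [CAlg.inclZ]
  | algebraMap r => rw [AlgHom.commutes, Module.algebraMap_end_apply, map_smul, Algebra.smul_def]
  | add y z _ _ hy hz => rw [map_add, LinearMap.add_apply, map_add, hy, hz, add_mul]
  | mul y z _ _ hy hz => rw [map_mul, Module.End.mul_apply, hy, hz, mul_assoc]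

theorem actNF_evalNF_one (m : k[X][X]) :
    actNF hreg (evalNF (CAlg.inclX a b c) (CAlg.inclZ a b c) m) 1 = m := by
  have hz (q : k[X]) : actNF hreg (CAlg.inclZ a b c q) 1 = C q := by
    induction q using Polynomial.induction_on with
    | C r => simp [CAlg.inclZ, Module.algebraMap_end_apply, Algebra.smul_def]
    | add p q hp hq => rw [map_add, map_add, LinearMap.add_apply, hp, hq, C_add]
    | monomial n r ih =>
      rw [pow_succ', mul_left_comm, map_mul, map_mul, Module.End.mul_apply, ih, CAlg.inclZ, aeval_X,
        actNF_z, ← monomial_zero_left, zMul_monomial, zMulXPow_zero, smul_C, smul_eq_mul,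
        mul_comm X]
  induction m using Polynomial.induction_on' with
  | add p q hp hq => rw [map_add, map_add, LinearMap.add_apply, hp, hq]
  | monomial i q =>
    rw [evalNF_monomial, map_mul, Module.End.mul_apply, hz]
    induction i with
    | zero => simp
    | succ i ih =>
      rw [pow_succ', map_mul, Module.End.mul_apply, ih, CAlg.inclX, aeval_X, actNF_x,
        X_mul_monomial]

include hreg in
/-- If no denominator vanishes, the monomials `x ^ i z ^ j` form a basis of `C(a, b, c)`: they span
because their span is a left ideal containing `1`, and they are independent because
`C(a, b, c)` acts on normal forms. -/
theorem CAlg.bijective_evalNF :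
    Function.Bijective (evalNF (CAlg.inclX a b c) (CAlg.inclZ a b c)) := by
  refine ⟨fun m m' h => ?_, fun u => ⟨actNF hreg u 1, ?_⟩⟩
  · rw [← actNF_evalNF_one hreg m, h, actNF_evalNF_one]
  · rw [evalNF_actNF, ← C_1, evalNF_C, map_one, mul_one]

end Action

/-! ### When `C(a, b, c)` is a twisted tensor product -/

section Criterion

open Polynomial

variable {k : Type*} [Field k]

theorem evalNF_map_C {A : Type*} [Ring A] [Algebra k A] (iA iB : k[X] →ₐ[k] A) (p : k[X]) :
    evalNF iA iB (p.map C) = iA p := by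
  induction p using Polynomial.induction_on' with
  | add p q hp hq => rw [Polynomial.map_add, map_add, hp, hq, map_add]
  | monomial i r =>
    rw [map_monomial, evalNF_monomial, C_eq_algebraMap, AlgHom.commutes, ← map_pow,
      ← Algebra.commutes, ← Algebra.smul_def, ← map_smul, X_pow_eq_monomial, smul_monomial,
      smul_eq_mul, mul_one]

theorem map_mem_of_mem_polyGrading {A : Type*} [Ring A] [Algebra k A] {V : Submodule k A}
    {f : k[X] →ₐ[k] A} (hf : f X ∈ V) {n : ℕ} {p : k[X]} (hp : p ∈ polyGrading k n) :
    f p ∈ V ^ n := by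
  obtain ⟨r, rfl⟩ := Submodule.mem_span_singleton.1 hp
  rw [map_smul, map_pow]
  exact Submodule.smul_mem _ _ (Submodule.pow_mem_pow _ hf n)

theorem CAlg.isGradedTTP {a b c : k} (hreg : ∀ n, c * leadCoeff a b c n ≠ 1) :
    IsGradedTTP (polyGrading k) (polyGrading k) (CAlg.grading a b c)
      (CAlg.inclX a b c) (CAlg.inclZ a b c) where
  gradedA := isGradedAlg_polyGrading k
  gradedB := isGradedAlg_polyGrading k
  gradedC := CAlg.isGradedAlg_grading a b c
  map_A n p hp := map_mem_of_mem_polyGrading (Submodule.subset_span (by simp [CAlg.inclX])) hp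
  map_B n p hp := map_mem_of_mem_polyGrading (Submodule.subset_span (by simp [CAlg.inclZ])) hp
  injective_A p q h := by
    rw [← evalNF_map_C _ (CAlg.inclZ a b c), ← evalNF_map_C _ (CAlg.inclZ a b c)] at h
    exact map_injective C C_injective ((CAlg.bijective_evalNF hreg).1 h)
  injective_B p q h := by
    rw [← evalNF_C (CAlg.inclX a b c), ← evalNF_C (CAlg.inclX a b c)] at h
    exact C_injective ((CAlg.bijective_evalNF hreg).1 h)
  bijective := (bijective_evalNF_iff _ _).1 (CAlg.bijective_evalNF hreg)

/-- If `x ^ i z ^ j` are independent in an algebra satisfying the relation, then a vanishing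
denominator forces the next numerator to vanish as well. -/
theorem add_mul_leadCoeff_eq_zero {A : Type*} [Ring A] [Algebra k A] {iA iB : k[X] →ₐ[k] A}
    {a b c : k} (h : iB X * iA X = a • iA X ^ 2 + b • (iA X * iB X) + c • iB X ^ 2)
    (hinj : Function.Injective (evalNF iA iB)) {n : ℕ} (hn : c * leadCoeff a b c n = 1)
    (hlt : ∀ m < n, c * leadCoeff a b c m ≠ 1) : a + b * leadCoeff a b c n = 0 := by
  have h0 := one_sub_smul_z_mul_x_pow h (n := n)
    fun i hi => evalNF_zMulXPow h fun j hj => hlt j (by omega)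
  rw [hn, sub_self, zero_smul, eq_comm, map_eq_zero_iff _ hinj] at h0
  rw [← C_eq_zero, ← coeff_zMulXPowRest, h0, coeff_zero]

/-- The exceptional algebra `C(1, -1, 1)` is `k⟨x, w⟩ / (w²)` with `w = x - z`, which has too many
monomials. Concretely, `z x²` is not a combination of the `x ^ i z ^ j`: the matrices below
satisfy the relation, and the upper right entry of `z x²` does not vanish, although that of every
`x ^ i z ^ j` does. -/
theorem CAlg.not_surjective_evalNF :
    ¬ Function.Surjective (evalNF (CAlg.inclX (1 : k) (-1) 1) (CAlg.inclZ (1 : k) (-1) 1)) := by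
  intro hsurj
  let M : Matrix (Fin 4) (Fin 4) k := !![0, 0, 0, 0; 0, 0, 1, 0; 0, 0, 0, 1; 0, 0, 0, 0]
  let N : Matrix (Fin 4) (Fin 4) k := !![0, -1, 0, 0; 0, 0, 1, 0; 0, 0, 0, 0; 0, 0, 0, 0]
  have hrel : N * M = (1 : k) • M ^ 2 + (-1 : k) • (M * N) + (1 : k) • N ^ 2 := by
    simp only [M, N, pow_two]
    ext i j
    fin_cases i <;> fin_cases j <;>
      simp [Matrix.mul_apply, Fin.sum_univ_four]
  let φ := CAlg.lift M N hrel
  have hN (q : k[X]) : aeval N q 0 3 = 0 := by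
    have h3 : ∀ j, (N ^ j) 0 3 = 0 := by
      intro j
      rcases j with _ | j
      · simp
      · rw [pow_succ, Matrix.mul_apply]
        simp [N, Fin.sum_univ_four]
    induction q using Polynomial.induction_on' with
    | add p q hp hq => rw [map_add, Matrix.add_apply, hp, hq, add_zero]
    | monomial j r =>
      rw [aeval_monomial, ← Algebra.smul_def, Matrix.smul_apply, h3, smul_zero]
  have hφ (m : k[X][X]) : φ (evalNF (CAlg.inclX 1 (-1) 1) (CAlg.inclZ 1 (-1) 1) m) 0 3 = 0 := by
    induction m using Polynomial.induction_on' with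
    | add p q hp hq => rw [map_add, map_add, Matrix.add_apply, hp, hq, add_zero]
    | monomial i q =>
      rw [evalNF_monomial, CAlg.inclX, CAlg.inclZ, aeval_X, map_mul, map_pow, ← aeval_algHom_apply,
        CAlg.lift_x, CAlg.lift_z]
      rcases i with _ | i
      · rw [pow_zero, one_mul, hN]
      · rw [pow_succ', mul_assoc, Matrix.mul_apply]
        simp [M, Fin.sum_univ_four]
  obtain ⟨m, hm⟩ := hsurj (CAlg.z 1 (-1) 1 * CAlg.x 1 (-1) 1 ^ 2)
  have := hφ m
  rw [hm, map_mul, map_pow, CAlg.lift_x, CAlg.lift_z] at this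
  simp [M, N, Matrix.mul_apply, pow_two, Fin.sum_univ_four] at this

theorem CAlg.isGradedTTP_one_iff_leadCoeff (a b : k) :
    IsGradedTTP (polyGrading k) (polyGrading k) (CAlg.grading a b 1)
      (CAlg.inclX a b 1) (CAlg.inclZ a b 1) ↔ ∀ n, leadCoeff a b 1 n ≠ 1 := by
  refine ⟨fun h => ?_, fun h => CAlg.isGradedTTP (by simpa using h)⟩
  by_contra! hex
  classical
  obtain ⟨n, hn, hlt⟩ : ∃ n, leadCoeff a b 1 n = 1 ∧ ∀ m < n, leadCoeff a b 1 m ≠ 1 :=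
    ⟨Nat.find hex, Nat.find_spec hex, fun m hm => Nat.find_min hex hm⟩
  have hbij := (bijective_evalNF_iff _ _).2 h.bijective
  have hab := add_mul_leadCoeff_eq_zero (a := a) (b := b) (c := 1)
    (by simpa [CAlg.inclX, CAlg.inclZ] using CAlg.z_mul_x a b 1) hbij.1 (n := n)
    (by rw [one_mul, hn]) (fun m hm => by rw [one_mul]; exact hlt m hm)
  rw [hn, mul_one] at hab
  obtain rfl := eq_neg_of_add_eq_zero_right hab
  -- As `a + b = 0`, the recursion is constant with value `a` from the index `1` on.
  have ha : a = 1 := by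
    rcases n with _ | n
    · simp [leadCoeff] at hn
    · rw [← hn, leadCoeff, one_mul, eq_div_iff (sub_ne_zero.2 (hlt n (by omega)).symm)]
      ring
  subst ha
  exact CAlg.not_surjective_evalNF hbij.2

theorem eval_fPoly_succ (a b : k) (n : ℕ) :
    MvPolynomial.eval ![a, b] (fPoly k (n + 1)) =
      -a * MvPolynomial.eval ![a, b] (efPoly k n).1 + MvPolynomial.eval ![a, b] (fPoly k n) := by
  simp [fPoly, efPoly]

/-- The recursion for `(e_n, f_n)` is the one for the numerators and the denominators of
`leadCoeff a b 1`. -/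
theorem leadCoeff_mul_eval_fPoly (a b : k) (n : ℕ)
    (h : ∀ m ≤ n, MvPolynomial.eval ![a, b] (fPoly k m) ≠ 0) :
    leadCoeff a b 1 (n + 1) * MvPolynomial.eval ![a, b] (fPoly k n) =
      a * MvPolynomial.eval ![a, b] (efPoly k n).1 := by
  induction n with
  | zero => simp [leadCoeff, fPoly, efPoly]
  | succ n ih =>
    have ih := ih fun m hm => h m (by omega)
    have hf := h (n + 1) le_rfl
    have he : MvPolynomial.eval ![a, b] (efPoly k (n + 1)).1 =
        b * MvPolynomial.eval ![a, b] (efPoly k n).1 + MvPolynomial.eval ![a, b] (fPoly k n) := by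
      simp [fPoly, efPoly]
    rw [eval_fPoly_succ] at hf ⊢
    rw [he, leadCoeff, one_mul]
    rw [neg_mul, ← ih] at hf ⊢
    have hne : 1 - leadCoeff a b 1 (n + 1) ≠ 0 := fun h0 => hf <| by
      rw [← sub_eq_zero.1 h0]
      ring
    rw [div_mul_eq_mul_div, div_eq_iff hne]
    linear_combination (b - b * leadCoeff a b 1 (n + 1)) * ih

theorem forall_leadCoeff_ne_one_iff (a b : k) :
    (∀ n, leadCoeff a b 1 n ≠ 1) ↔ ∀ n, MvPolynomial.eval ![a, b] (fPoly k n) ≠ 0 := by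
  have key (n : ℕ) (h : ∀ m ≤ n, MvPolynomial.eval ![a, b] (fPoly k m) ≠ 0) :
      MvPolynomial.eval ![a, b] (fPoly k (n + 1)) =
        MvPolynomial.eval ![a, b] (fPoly k n) * (1 - leadCoeff a b 1 (n + 1)) := by
    rw [eval_fPoly_succ]
    linear_combination leadCoeff_mul_eval_fPoly a b n h
  constructor
  · intro h n
    induction n using Nat.strong_induction_on with
    | _ n ih =>
      rcases n with _ | n
      · simp [fPoly, efPoly]
      · rw [key n fun m hm => ih m (by omega)]
        exact mul_ne_zero (ih n (by omega)) (sub_ne_zero.2 (h _).symm)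
  · intro h n hn
    rcases n with _ | n
    · simp [leadCoeff] at hn
    · apply h (n + 1)
      rw [key n fun m _ => h m, hn, sub_self, mul_zero]

theorem leadCoeff_zero_left (b c : k) (n : ℕ) : leadCoeff 0 b c n = 0 := by
  induction n with
  | zero => rfl
  | succ n ih => simp [leadCoeff, ih]

theorem mul_leadCoeff_ne_one {a c : k} (h : a = 0 ∨ c = 0) (b : k) (n : ℕ) :
    c * leadCoeff a b c n ≠ 1 := by
  rcases h with rfl | rfl
  · simp [leadCoeff_zero_left]
  · simp

end Criterion

/-! ### Twisted tensor products of `k[x]` and `k[z]` -/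

section Classification

open Polynomial

variable {k : Type*} [Field k] {A : Type*} [Ring A] [Algebra k A] {𝒞 : ℕ → Submodule k A}
  {iA iB : k[X] →ₐ[k] A}

theorem adjoin_eq_top_of_surjective_evalNF (hsurj : Function.Surjective (evalNF iA iB)) :
    Algebra.adjoin k {iA X, iB X} = ⊤ := by
  rw [eq_top_iff]
  rintro u -
  obtain ⟨m, rfl⟩ := hsurj u
  have hx : iA X ∈ Algebra.adjoin k {iA X, iB X} := Algebra.subset_adjoin (by simp)
  have hz (q : k[X]) : iB q ∈ Algebra.adjoin k {iA X, iB X} := by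
    rw [← aeval_X_left_apply q, ← aeval_algHom_apply]
    exact Algebra.adjoin_mono (by simp) (aeval_mem_adjoin_singleton k (iB X))
  induction m using Polynomial.induction_on' with
  | add p q hp hq => rw [map_add]; exact add_mem hp hq
  | monomial i q => rw [evalNF_monomial]; exact mul_mem (pow_mem hx i) (hz q)

/-- The span of the monomials `x ^ i z ^ j` of degree `n`. -/
def monomialSpan (iA iB : k[X] →ₐ[k] A) (n : ℕ) : Submodule k A :=
  Submodule.span k {w | ∃ i j, i + j = n ∧ iA X ^ i * iB X ^ j = w}

theorem monomialSpan_le (iA iB : k[X] →ₐ[k] A) (n : ℕ) :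
    monomialSpan iA iB n ≤ Submodule.span k {iA X, iB X} ^ n := by
  refine Submodule.span_le.2 ?_
  rintro _ ⟨i, j, rfl, rfl⟩
  rw [SetLike.mem_coe, pow_add]
  exact Submodule.mul_mem_mul (Submodule.pow_mem_pow _ (Submodule.subset_span (by simp)) i)
    (Submodule.pow_mem_pow _ (Submodule.subset_span (by simp)) j)

theorem iSup_monomialSpan_eq_top (hsurj : Function.Surjective (evalNF iA iB)) :
    ⨆ n, monomialSpan iA iB n = ⊤ := by
  rw [eq_top_iff]
  rintro u -
  obtain ⟨m, rfl⟩ := hsurj u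
  induction m using Polynomial.induction_on' with
  | add p q hp hq => rw [map_add]; exact add_mem hp hq
  | monomial i q =>
    induction q using Polynomial.induction_on' with
    | add p q hp hq => rw [map_add, map_add]; exact add_mem hp hq
    | monomial j r =>
      have hr : monomial j r = r • X ^ j := by
        rw [X_pow_eq_monomial, smul_monomial, smul_eq_mul, mul_one]
      rw [evalNF_monomial, hr, map_smul, map_pow, mul_smul_comm]
      exact Submodule.smul_mem _ _ (Submodule.mem_iSup_of_mem (i + j)
        (Submodule.subset_span ⟨i, j, rfl, rfl⟩))

namespace IsGradedTTP

variable (T : IsGradedTTP (polyGrading k) (polyGrading k) 𝒞 iA iB)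
include T

theorem bijective_evalNF : Function.Bijective (evalNF iA iB) :=
  (bijective_evalNF_iff iA iB).2 T.bijective

theorem x_mem : iA X ∈ 𝒞 1 :=
  T.map_A 1 X (by simp [polyGrading])

theorem z_mem : iB X ∈ 𝒞 1 :=
  T.map_B 1 X (by simp [polyGrading])

theorem span_pow_le (n : ℕ) : Submodule.span k {iA X, iB X} ^ n ≤ 𝒞 n := by
  have := T.gradedC.gradedMonoid
  have h1 : Submodule.span k {iA X, iB X} ≤ 𝒞 1 := by
    rw [Submodule.span_le, Set.insert_subset_iff, Set.singleton_subset_iff]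
    exact ⟨T.x_mem, T.z_mem⟩
  induction n with
  | zero =>
    rw [pow_zero, Submodule.one_le]
    exact SetLike.GradedOne.one_mem
  | succ n ih =>
    rw [pow_succ, Submodule.mul_le]
    exact fun x hx y hy => SetLike.GradedMul.mul_mem (ih hx) (h1 hy)

/-- The grading of a twisted tensor product is determined by the monomials `x ^ i z ^ j`, as
these span. -/
theorem monomialSpan_eq (n : ℕ) : monomialSpan iA iB n = 𝒞 n :=
  eq_of_le_of_iSupIndep_of_iSup_eq_top
    (fun n => (monomialSpan_le iA iB n).trans (T.span_pow_le n))
    T.gradedC.isInternal.submodule_iSupIndep (iSup_monomialSpan_eq_top T.bijective_evalNF.2) n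

theorem span_pow_eq (n : ℕ) : Submodule.span k {iA X, iB X} ^ n = 𝒞 n :=
  le_antisymm (T.span_pow_le n) (T.monomialSpan_eq n ▸ monomialSpan_le iA iB n)

theorem exists_relation : ∃ a b c : k,
    iB X * iA X = a • iA X ^ 2 + b • (iA X * iB X) + c • iB X ^ 2 := by
  have := T.gradedC.gradedMonoid
  have h : iB X * iA X ∈ 𝒞 2 := SetLike.GradedMul.mul_mem T.z_mem T.x_mem
  rw [← T.monomialSpan_eq] at h
  have hle : monomialSpan iA iB 2 ≤ Submodule.span k {iA X ^ 2, iA X * iB X, iB X ^ 2} := by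
    refine Submodule.span_le.2 ?_
    rintro _ ⟨i, j, hij, rfl⟩
    apply Submodule.subset_span
    obtain ⟨rfl, rfl⟩ | ⟨rfl, rfl⟩ | ⟨rfl, rfl⟩ :
        (i = 0 ∧ j = 2) ∨ (i = 1 ∧ j = 1) ∨ (i = 2 ∧ j = 0) := by omega
    all_goals simp
  obtain ⟨a, b, c, h⟩ := Submodule.mem_span_triple.1 (hle h)
  exact ⟨a, b, c, h.symm⟩

theorem exists_eq_of_mem (m : 𝒞 1) : ∃ p q : k,
    m = p • (⟨iA X, T.x_mem⟩ : 𝒞 1) + q • (⟨iB X, T.z_mem⟩ : 𝒞 1) := by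
  have hm := (T.span_pow_eq 1).ge m.2
  rw [pow_one, Submodule.mem_span_pair] at hm
  obtain ⟨p, q, h⟩ := hm
  exact ⟨p, q, Subtype.ext h.symm⟩

/-- Linear maps on the degree-one part are determined by the images of `x` and `z`. -/
theorem linearMap_ext {V : Type*} [AddCommGroup V] [Module k V] {f g : 𝒞 1 →ₗ[k] V}
    (hx : f ⟨iA X, T.x_mem⟩ = g ⟨iA X, T.x_mem⟩) (hz : f ⟨iB X, T.z_mem⟩ = g ⟨iB X, T.z_mem⟩) :
    f = g := by
  ext m
  obtain ⟨p, q, rfl⟩ := T.exists_eq_of_mem m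
  simp only [map_add, map_smul, hx, hz]

end IsGradedTTP

section Relation

variable {a b c : k} (h : iB X * iA X = a • iA X ^ 2 + b • (iA X * iB X) + c • iB X ^ 2)

theorem lift_inclX (p : k[X]) :
    CAlg.lift (iA X) (iB X) h (CAlg.inclX a b c p) = iA p := by
  rw [CAlg.inclX, ← aeval_algHom_apply, CAlg.lift_x, aeval_algHom_apply, aeval_X_left_apply]

theorem lift_inclZ (p : k[X]) :
    CAlg.lift (iA X) (iB X) h (CAlg.inclZ a b c p) = iB p := by
  rw [CAlg.inclZ, ← aeval_algHom_apply, CAlg.lift_z, aeval_algHom_apply, aeval_X_left_apply]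

theorem lift_evalNF (m : k[X][X]) :
    CAlg.lift (iA X) (iB X) h (evalNF (CAlg.inclX a b c) (CAlg.inclZ a b c) m) =
      evalNF iA iB m := by
  induction m using Polynomial.induction_on' with
  | add p q hp hq => rw [map_add, map_add, hp, hq, map_add]
  | monomial i q => rw [evalNF_monomial, evalNF_monomial, map_mul, map_pow, lift_inclX, lift_inclZ]

variable (T : IsGradedTTP (polyGrading k) (polyGrading k) 𝒞 iA iB)
include T

theorem IsGradedTTP.surjective_lift : Function.Surjective (CAlg.lift (iA X) (iB X) h) := by
  intro u
  obtain ⟨m, rfl⟩ := T.bijective_evalNF.2 u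
  exact ⟨_, lift_evalNF h m⟩

/-- If no denominator vanishes, so that the `x ^ i z ^ j` span `C(a, b, c)`, then it maps
isomorphically to every twisted tensor product satisfying its relation. -/
theorem IsGradedTTP.injective_lift (hreg : ∀ n, c * leadCoeff a b c n ≠ 1) :
    Function.Injective (CAlg.lift (iA X) (iB X) h) := by
  intro u v huv
  obtain ⟨m, rfl⟩ := (CAlg.bijective_evalNF hreg).2 u
  obtain ⟨m', rfl⟩ := (CAlg.bijective_evalNF hreg).2 v
  rw [lift_evalNF, lift_evalNF] at huv
  rw [T.bijective_evalNF.1 huv]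

theorem IsGradedTTP.isoTTP (hinj : Function.Injective (CAlg.lift (iA X) (iB X) h)) :
    IsoTTP (polyGrading k) (polyGrading k) 𝒞 iA iB
      (CAlg.grading a b c) (CAlg.inclX a b c) (CAlg.inclZ a b c) := by
  let e := AlgEquiv.ofBijective (CAlg.lift (iA X) (iB X) h) ⟨hinj, T.surjective_lift h⟩
  have he (u) : e u = CAlg.lift (iA X) (iB X) h u := rfl
  refine ⟨.refl, .refl, e.symm, fun n => Submodule.map_id _, fun n => Submodule.map_id _,
    fun n => ?_, fun p => ?_, fun p => ?_⟩
  · have hmap : (CAlg.grading a b c n).map (CAlg.lift (iA X) (iB X) h).toLinearMap = 𝒞 n := by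
      rw [CAlg.grading, Submodule.map_pow, Submodule.map_span, Set.image_pair, ← T.span_pow_eq]
      simp
    rw [← hmap, ← Submodule.map_comp]
    convert Submodule.map_id _
    ext u
    exact e.symm_apply_apply u
  · rw [AlgEquiv.symm_apply_eq, he]
    exact (lift_inclX h p).symm
  · rw [AlgEquiv.symm_apply_eq, he]
    exact (lift_inclZ h p).symm

/-- A twisted tensor product isomorphic to `C(a, b, c)` is quadratic: modulo the degree-two
elements of the kernel, the generators `x` and `z` of the tensor algebra satisfy the relation of
`C(a, b, c)`, so that the quotient map factors through `C(a, b, c)`. -/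
theorem IsGradedTTP.isQuadratic (hinj : Function.Injective (CAlg.lift (iA X) (iB X) h)) :
    IsQuadratic 𝒞 where
  graded := T.gradedC
  generated := by
    rw [eq_top_iff, ← adjoin_eq_top_of_surjective_evalNF T.bijective_evalNF.2]
    apply Algebra.adjoin_mono
    rw [Set.insert_subset_iff, Set.singleton_subset_iff]
    exact ⟨T.x_mem, T.z_mem⟩
  kernel := by
    set J := TwoSidedIdeal.span {w | w ∈ LinearMap.range (TensorAlgebra.ι k (M := 𝒞 1)) ^ 2 ∧
      tensorProj 𝒞 w = 0}
    refine le_antisymm (fun w hw => ?_)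
      (TwoSidedIdeal.span_le.2 fun w hw => (TwoSidedIdeal.mem_ker _).2 hw.2)
    let π := RingCon.mkₐ k J.ringCon
    have hπ (w) : π w = 0 ↔ w ∈ J := by
      rw [TwoSidedIdeal.mem_iff, ← RingCon.eq]
      rfl
    let X₁ := TensorAlgebra.ι k (⟨iA X, T.x_mem⟩ : 𝒞 1)
    let Z₁ := TensorAlgebra.ι k (⟨iB X, T.z_mem⟩ : 𝒞 1)
    have hX₁ : tensorProj 𝒞 X₁ = iA X := by simp [tensorProj, X₁]
    have hZ₁ : tensorProj 𝒞 Z₁ = iB X := by simp [tensorProj, Z₁]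
    have hrel : π Z₁ * π X₁ = a • π X₁ ^ 2 + b • (π X₁ * π Z₁) + c • π Z₁ ^ 2 := by
      rw [← sub_eq_zero]
      simp only [← map_mul, ← map_pow, ← map_smul, ← map_add, ← map_sub]
      rw [hπ]
      refine TwoSidedIdeal.subset_span ⟨?_, ?_⟩
      · have hmem (u v : 𝒞 1) : TensorAlgebra.ι k u * TensorAlgebra.ι k v ∈
            LinearMap.range (TensorAlgebra.ι k (M := 𝒞 1)) ^ 2 := by
          rw [pow_two]
          exact Submodule.mul_mem_mul ⟨u, rfl⟩ ⟨v, rfl⟩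
        rw [pow_two X₁, pow_two Z₁]
        exact sub_mem (hmem _ _) (add_mem (add_mem (Submodule.smul_mem _ _ (hmem _ _))
          (Submodule.smul_mem _ _ (hmem _ _))) (Submodule.smul_mem _ _ (hmem _ _)))
      · simp only [map_mul, map_pow, map_smul, map_add, map_sub, hX₁, hZ₁]
        rw [h, sub_self]
    let e := AlgEquiv.ofBijective (CAlg.lift (iA X) (iB X) h) ⟨hinj, T.surjective_lift h⟩
    have hfac : ((CAlg.lift _ _ hrel).comp e.symm.toAlgHom).comp (tensorProj 𝒞) = π := by
      have hx : e.symm (iA X) = CAlg.x a b c :=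
        (AlgEquiv.symm_apply_eq _).2 (CAlg.lift_x _ _ h).symm
      have hz : e.symm (iB X) = CAlg.z a b c :=
        (AlgEquiv.symm_apply_eq _).2 (CAlg.lift_z _ _ h).symm
      apply TensorAlgebra.hom_ext
      apply T.linearMap_ext
      · change CAlg.lift _ _ hrel (e.symm (tensorProj 𝒞 X₁)) = π X₁
        rw [hX₁, hx, CAlg.lift_x]
      · change CAlg.lift _ _ hrel (e.symm (tensorProj 𝒞 Z₁)) = π Z₁
        rw [hZ₁, hz, CAlg.lift_z]
    rw [← hπ, ← hfac, AlgHom.comp_apply, (TwoSidedIdeal.mem_ker _).1 hw, map_zero]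

/-- In a quadratic twisted tensor product the relation `z x = a x² + b x z + c z²` implies all
others: the linear map `L` sending `x ^ i z ^ j` to the same monomial of `C(a, b, c)` respects
products of degree two, so that `T(C_1) → C(a, b, c)` kills the quadratic relations. -/
theorem IsGradedTTP.injective_lift_of_isQuadratic (hq : IsQuadratic 𝒞) :
    Function.Injective (CAlg.lift (iA X) (iB X) h) := by
  let E := LinearEquiv.ofBijective (evalNF iA iB) T.bijective_evalNF
  let L : A →ₗ[k] CAlg a b c := evalNF (CAlg.inclX a b c) (CAlg.inclZ a b c) ∘ₗ E.symm.toLinearMap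
  have hL (i j : ℕ) : L (iA X ^ i * iB X ^ j) = CAlg.x a b c ^ i * CAlg.z a b c ^ j := by
    have hE : E.symm (iA X ^ i * iB X ^ j) = monomial i (X ^ j) := by
      rw [LinearEquiv.symm_apply_eq]
      simp [E]
    simp [L, hE, CAlg.inclX, CAlg.inclZ]
  have hxx : L (iA X * iA X) = CAlg.x a b c * CAlg.x a b c := by simpa [pow_two] using hL 2 0
  have hxz : L (iA X * iB X) = CAlg.x a b c * CAlg.z a b c := by simpa using hL 1 1
  have hzz : L (iB X * iB X) = CAlg.z a b c * CAlg.z a b c := by simpa [pow_two] using hL 0 2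
  have hx : L (iA X) = CAlg.x a b c := by simpa using hL 1 0
  have hz : L (iB X) = CAlg.z a b c := by simpa using hL 0 1
  have hzx : L (iB X * iA X) = CAlg.z a b c * CAlg.x a b c := by
    rw [h, CAlg.z_mul_x]
    simp only [map_add, map_smul, pow_two, hxx, hxz, hzz]
  let ψ : TensorAlgebra k (𝒞 1) →ₐ[k] CAlg a b c := TensorAlgebra.lift k (L ∘ₗ (𝒞 1).subtype)
  have hψι (u : 𝒞 1) : ψ (TensorAlgebra.ι k u) = L u := by simp [ψ]
  have htι (u : 𝒞 1) : tensorProj 𝒞 (TensorAlgebra.ι k u) = u := by simp [tensorProj]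
  have hdeg2 : ∀ w ∈ LinearMap.range (TensorAlgebra.ι k (M := 𝒞 1)) ^ 2,
      ψ w = L (tensorProj 𝒞 w) := by
    intro w hw
    rw [pow_two] at hw
    induction hw using Submodule.mul_induction_on' with
    | mem_mul_mem u hu v hv =>
      obtain ⟨u, rfl⟩ := hu
      obtain ⟨v, rfl⟩ := hv
      rw [map_mul, map_mul, hψι, hψι, htι, htι]
      obtain ⟨p, q, rfl⟩ := T.exists_eq_of_mem u
      obtain ⟨r, s, rfl⟩ := T.exists_eq_of_mem v
      simp only [Submodule.coe_add, Submodule.coe_smul, mul_add, add_mul, map_add, map_smul,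
        smul_mul_assoc, mul_smul_comm, hx, hz, hxx, hxz, hzz, hzx]
    | add u _ v _ hu hv => rw [map_add, map_add, hu, hv, map_add]
  have hker : TwoSidedIdeal.ker (tensorProj 𝒞) ≤ TwoSidedIdeal.ker ψ := by
    rw [hq.kernel, TwoSidedIdeal.span_le]
    intro w hw
    exact (TwoSidedIdeal.mem_ker _).2 (by rw [hdeg2 w hw.1, hw.2, map_zero])
  have hψsurj : Function.Surjective ψ := by
    rw [← AlgHom.range_eq_top, eq_top_iff, ← CAlg.adjoin_x_z, Algebra.adjoin_le_iff,
      Set.insert_subset_iff, Set.singleton_subset_iff]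
    exact ⟨⟨TensorAlgebra.ι k ⟨iA X, T.x_mem⟩, (hψι _).trans hx⟩,
      ⟨TensorAlgebra.ι k ⟨iB X, T.z_mem⟩, (hψι _).trans hz⟩⟩
  have hcomp : (CAlg.lift (iA X) (iB X) h).comp ψ = tensorProj 𝒞 := by
    apply TensorAlgebra.hom_ext
    apply T.linearMap_ext
    · change CAlg.lift (iA X) (iB X) h (ψ (TensorAlgebra.ι k _)) =
        tensorProj 𝒞 (TensorAlgebra.ι k _)
      rw [hψι, htι, hx, CAlg.lift_x]
    · change CAlg.lift (iA X) (iB X) h (ψ (TensorAlgebra.ι k _)) =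
        tensorProj 𝒞 (TensorAlgebra.ι k _)
      rw [hψι, htι, hz, CAlg.lift_z]
  rw [injective_iff_map_eq_zero]
  intro u hu
  obtain ⟨w, rfl⟩ := hψsurj u
  rw [← AlgHom.comp_apply, hcomp] at hu
  exact (TwoSidedIdeal.mem_ker _).1 (hker ((TwoSidedIdeal.mem_ker _).2 hu))

end Relation

/-! ### Rescaling `z` -/

/-- The automorphism `z ↦ s z` of `k[z]`. -/
def scaleX (s : k) (hs : s ≠ 0) : k[X] ≃ₐ[k] k[X] :=
  AlgEquiv.ofAlgHom (aeval (s • X)) (aeval (s⁻¹ • X))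
    (by ext; simp [smul_smul, hs]) (by ext; simp [smul_smul, hs])

theorem scaleX_X {s : k} (hs : s ≠ 0) : scaleX s hs X = s • X := by simp [scaleX]

theorem map_scaleX_polyGrading {s : k} (hs : s ≠ 0) (n : ℕ) :
    (polyGrading k n).map (scaleX s hs).toLinearMap = polyGrading k n := by
  rw [polyGrading, Submodule.map_span, Set.image_singleton, AlgEquiv.toLinearMap_apply, map_pow,
    scaleX_X, _root_.smul_pow]
  exact Submodule.span_singleton_smul_eq (IsUnit.mk0 _ (pow_ne_zero n hs)) _

theorem IsGradedTTP.comp_scaleX (T : IsGradedTTP (polyGrading k) (polyGrading k) 𝒞 iA iB)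
    {s : k} (hs : s ≠ 0) : IsGradedTTP (polyGrading k) (polyGrading k) 𝒞 iA
      (iB.comp (scaleX s hs).toAlgHom) where
  gradedA := T.gradedA
  gradedB := T.gradedB
  gradedC := T.gradedC
  map_A := T.map_A
  map_B n p hp := T.map_B n _ (by
    rw [← map_scaleX_polyGrading hs]
    exact ⟨p, hp, rfl⟩)
  injective_A := T.injective_A
  injective_B := T.injective_B.comp (scaleX s hs).injective
  bijective := by
    have h : mulMap iA (iB.comp (scaleX s hs).toAlgHom) = mulMap iA iB ∘ₗ
        (TensorProduct.congr (.refl k _) (scaleX s hs).toLinearEquiv).toLinearMap := by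
      apply TensorProduct.ext'
      intro p q
      simp [mulMap]
    rw [h, LinearMap.coe_comp]
    exact T.bijective.comp (LinearEquiv.bijective _)

theorem isoTTP_of_comp_scaleX {C' : Type*} [Ring C'] [Algebra k C'] {𝒞' : ℕ → Submodule k C'}
    {iA' iB' : k[X] →ₐ[k] C'} {s : k} (hs : s ≠ 0)
    (h : IsoTTP (polyGrading k) (polyGrading k) 𝒞 iA (iB.comp (scaleX s hs).toAlgHom)
      𝒞' iA' iB') :
    IsoTTP (polyGrading k) (polyGrading k) 𝒞 iA iB 𝒞' iA' iB' := by
  obtain ⟨α, β, γ, hα, hβ, hγ, hA, hB⟩ := h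
  refine ⟨α, (scaleX s hs).symm.trans β, γ, hα, fun n => ?_, hγ, hA, fun p => ?_⟩
  · conv_lhs => rw [← map_scaleX_polyGrading hs, ← Submodule.map_comp]
    convert hβ n
    ext p
    simp
  · have := hB ((scaleX s hs).symm p)
    simpa using this

theorem IsGradedTTP.exists_isoTTP (T : IsGradedTTP (polyGrading k) (polyGrading k) 𝒞 iA iB)
    (hq : IsQuadratic 𝒞) : ∃ a b c : k, (c = 1 ∨ c = 0) ∧
      IsoTTP (polyGrading k) (polyGrading k) 𝒞 iA iB
        (CAlg.grading a b c) (CAlg.inclX a b c) (CAlg.inclZ a b c) := by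
  obtain ⟨a, b, c, h⟩ := T.exists_relation
  by_cases hc : c = 0
  · exact ⟨a, b, c, .inr hc, T.isoTTP h (T.injective_lift_of_isQuadratic h hq)⟩
  · have T' := T.comp_scaleX hc
    have h' : (iB.comp (scaleX c hc).toAlgHom) X * iA X = (c * a) • iA X ^ 2 +
        b • (iA X * (iB.comp (scaleX c hc).toAlgHom) X) +
          (1 : k) • (iB.comp (scaleX c hc).toAlgHom) X ^ 2 := by
      have hX : (iB.comp (scaleX c hc).toAlgHom) X = c • iB X := by
        rw [← map_smul, ← scaleX_X hc]
        rfl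
      rw [hX, smul_mul_assoc, h]
      simp only [smul_add, smul_smul, mul_smul_comm, _root_.smul_pow, one_mul, pow_two c,
        mul_comm b c]
    exact ⟨c * a, b, 1, .inl rfl, isoTTP_of_comp_scaleX hc
      (T'.isoTTP h' (T'.injective_lift_of_isQuadratic h' hq))⟩

end Classification

end TwistedTensor

end

theorem theorem3p4 (k : Type u) [Field k] [IsAlgClosed k] :
    -- `C(a, b, 1)` is a graded twisted tensor product of `k[x]` and `k[z]` iff all `f_n(a, b) ≠ 0`
    (∀ a b : k,
      TwistedTensor.IsGradedTTP (TwistedTensor.polyGrading k) (TwistedTensor.polyGrading k)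
          (TwistedTensor.CAlg.grading a b 1)
          (TwistedTensor.CAlg.inclX a b 1) (TwistedTensor.CAlg.inclZ a b 1) ↔
        ∀ n : ℕ, MvPolynomial.eval ![a, b] (TwistedTensor.fPoly k n) ≠ 0) ∧
    -- `C(a, b, 0)` is always a graded twisted tensor product of `k[x]` and `k[z]`
    (∀ a b : k,
      TwistedTensor.IsGradedTTP (TwistedTensor.polyGrading k) (TwistedTensor.polyGrading k)
        (TwistedTensor.CAlg.grading a b 0)
        (TwistedTensor.CAlg.inclX a b 0) (TwistedTensor.CAlg.inclZ a b 0)) ∧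
    -- a graded twisted tensor product with `z x = a x² + b x z + c z²`, where `a = 0` or `c = 0`,
    -- is quadratic and isomorphic to `C(a, b, c)`
    (∀ (C : Type v) [Ring C] [Algebra k C] (𝒞 : ℕ → Submodule k C)
      (iA iB : Polynomial k →ₐ[k] C) (a b c : k),
      TwistedTensor.IsGradedTTP (TwistedTensor.polyGrading k) (TwistedTensor.polyGrading k)
        𝒞 iA iB →
      iB Polynomial.X * iA Polynomial.X =
        a • iA Polynomial.X ^ 2 + b • (iA Polynomial.X * iB Polynomial.X)
          + c • iB Polynomial.X ^ 2 →
      a = 0 ∨ c = 0 →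
      TwistedTensor.IsQuadratic 𝒞 ∧
        TwistedTensor.IsoTTP (TwistedTensor.polyGrading k) (TwistedTensor.polyGrading k)
          𝒞 iA iB (TwistedTensor.CAlg.grading a b c)
          (TwistedTensor.CAlg.inclX a b c) (TwistedTensor.CAlg.inclZ a b c)) ∧
    -- every quadratic twisted tensor product of `k[x]` and `k[z]` is isomorphic to some
    -- `C(a, b, 1)` or `C(a, b, 0)`
    (∀ (C : Type v) [Ring C] [Algebra k C] (𝒞 : ℕ → Submodule k C)
      (iA iB : Polynomial k →ₐ[k] C),
      TwistedTensor.IsGradedTTP (TwistedTensor.polyGrading k) (TwistedTensor.polyGrading k)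
        𝒞 iA iB →
      TwistedTensor.IsQuadratic 𝒞 →
      ∃ a b c : k, (c = 1 ∨ c = 0) ∧
        TwistedTensor.IsoTTP (TwistedTensor.polyGrading k) (TwistedTensor.polyGrading k)
          𝒞 iA iB (TwistedTensor.CAlg.grading a b c)
          (TwistedTensor.CAlg.inclX a b c) (TwistedTensor.CAlg.inclZ a b c)) := by
  refine ⟨fun a b => ?_, fun a b => ?_, fun C _ _ 𝒞 iA iB a b c T h hac => ?_,
    fun C _ _ 𝒞 iA iB T hq => T.exists_isoTTP hq⟩
  · rw [TwistedTensor.CAlg.isGradedTTP_one_iff_leadCoeff,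
      TwistedTensor.forall_leadCoeff_ne_one_iff]
  · exact TwistedTensor.CAlg.isGradedTTP (TwistedTensor.mul_leadCoeff_ne_one (.inr rfl) b)
  · have hinj := T.injective_lift h (TwistedTensor.mul_leadCoeff_ne_one hac b)
    exact ⟨T.isQuadratic h hinj, T.isoTTP h hinj⟩
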